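/- Let $\mathcal X,\mathcal Y$ be measurable spaces. A kernel on $\mathcal X$ is a function $\kappa:\mathcal X\times\mathcal X\to\mathbb R$ all of whose finite Gram matrices $(\kappa(x_i,x_j))_{i,j}$ are positive semidefinite; $\mathcal H_\kappa$ denotes its reproducing kernel Hilbert space and $\mathcal H_\kappa^B=\{f\in\mathcal H_\kappa:\|f\|_{\mathcal H_\kappa}\le B\}$. For a distribution $\mathcal D$ on $\mathcal X\times\mathcal Y$ and a measurable loss $\ell:\mathbb R\times\mathcal Y\to\mathbb R$, write $\mathcal L_{\mathcal D}(f)=\mathbb E_{(x,y)\sim\mathcal D}\,\ell(f(x),y)$. The loss is $L$-Lipschitz if $|\ell(t,y)-\ell(t',y)|\le L|t-t'|$ for all $t,t'\in\mathbb R$, $y\in\mathcal Y$. **Lemma.** There is a universal constant $c_2>0$ with the following property. Let $\mathcal D$ be a distribution on $\mathcal X\times\mathcal Y$, let $\ell:\mathbb R\times\mathcal Y\to\mathbb R$ be an $L$-Lipschitz loss, let $C,\epsilon,\delta>0$ and $M,\tilde\delta\in\mathbb R$, and let $\kappa_1,\kappa_2$ be two independent random kernels on $\mathcal X$ (jointly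 measurable in the randomness and the two arguments). Assume that - almost surely, $\kappa_1(x,x)\le C$ and $\kappa_2(x,x)\le C$ for all $x\in\mathcal X$; - for all $x,x'\in\mathcal X$, $\Pr_{\kappa_1,\kappa_2}\left(|\kappa_1(x,x')-\kappa_2(x,x')|\ge\epsilon\right)\le\tilde\delta$, where $$\tilde\delta< c_2\,\frac{\epsilon^2\,\delta}{C^2\,\max\{1,\log(1/\delta)\}^2}.$$ Then, with probability at least $1-\delta$ over the choice of $\kappa_1,\kappa_2$, for every $f_1\in\mathcal H_{\kappa_1}^{M}$ whose expected loss is well defined and finite there is $f_2\in\mathcal H_{\kappa_2}^{\sqrt2 M}$ whose expected loss is well defined and finite and such that $$\mathcal L_{\mathcal D}(f_2)\le\mathcal L_{\mathcal D}(f_1)+4LM\sqrt{\epsilon}.$$ -/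

import Mathlib

open MeasureTheory ProbabilityTheory
open scoped NNReal

/-- A real-valued function `κ` on `X × X` is a (reproducing) kernel if, for all finite sequences
`x₁, …, x_r` of points of `X`, the Gram matrix `(κ (x i) (x j))` is positive semidefinite. -/
def IsReproducingKernel {X : Type*} (κ : X → X → ℝ) : Prop :=
  ∀ (r : ℕ) (x : Fin r → X), (Matrix.of fun i j => κ (x i) (x j)).PosSemidef

/-- A scalar kernel as an operator-valued one: `κ x y` acts on `ℝ` by multiplication. -/
noncomputable def kernelMatrix {X : Type*} (κ : X → X → ℝ) : Matrix X X (ℝ →L[ℝ] ℝ) :=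
  Matrix.of fun x y => κ x y • (1 : ℝ →L[ℝ] ℝ)

theorem IsReproducingKernel.symm {X : Type*} {κ : X → X → ℝ} (hκ : IsReproducingKernel κ)
    (x y : X) : κ x y = κ y x := by
  have h := (hκ 2 ![x, y]).1.apply 1 0
  simpa using h

theorem IsReproducingKernel.sum_nonneg {X : Type*} {κ : X → X → ℝ} (hκ : IsReproducingKernel κ)
    (s : Finset X) (c : X → ℝ) : 0 ≤ ∑ x ∈ s, ∑ y ∈ s, c x * c y * κ x y := by
  have h := (hκ s.card (fun i => (s.equivFin.symm i : X))).dotProduct_mulVec_nonneg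
    (fun i => c (s.equivFin.symm i : X))
  have e : ∀ g : X → ℝ, ∑ i, g (s.equivFin.symm i : X) = ∑ x ∈ s, g x := fun g => by
    rw [← Finset.sum_coe_sort s g]
    exact Equiv.sum_comp s.equivFin.symm (fun x : s => g x)
  simp only [dotProduct, Matrix.mulVec, Matrix.of_apply, Pi.star_apply, star_trivial] at h
  rw [e (fun x => c x * ∑ j, κ x (s.equivFin.symm j : X) * c (s.equivFin.symm j : X))] at h
  refine h.trans_eq (Finset.sum_congr rfl fun x _ => ?_)
  rw [e (fun y => κ x y * c y), Finset.mul_sum]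
  exact Finset.sum_congr rfl fun y _ => by ring

theorem IsReproducingKernel.posSemidef_kernelMatrix {X : Type*} {κ : X → X → ℝ}
    (hκ : IsReproducingKernel κ) : (kernelMatrix κ).PosSemidef := by
  have key := (RKHS.posSemidef_tfae (K := kernelMatrix κ)).out 0 2
  refine key.mpr ⟨?_, fun v => ?_⟩
  · refine Matrix.IsHermitian.ext fun x y => ?_
    simp only [kernelMatrix, Matrix.of_apply, star_smul, star_one, star_trivial, hκ.symm x y]
  · have h := hκ.sum_nonneg v.support v
    simp only [Finsupp.sum, kernelMatrix, Matrix.of_apply]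
    refine h.trans_eq ?_
    rw [Finset.sum_comm]
    simp only [RCLike.re_to_real]
    refine Finset.sum_congr rfl fun x _ => Finset.sum_congr rfl fun y _ => ?_
    simp
    ring

/-- The ball `ℋ_κ^B` of radius `B` in the reproducing kernel Hilbert space `ℋ_κ` of the kernel `κ`,
as a set of functions on `X`. -/
noncomputable def kernelBall {X : Type*} (κ : X → X → ℝ) (hκ : IsReproducingKernel κ) (B : ℝ) :
    Set (X → ℝ) :=
  haveI : Fact (kernelMatrix κ).PosSemidef := ⟨hκ.posSemidef_kernelMatrix⟩
  {f | ∃ h : RKHS.OfKernel (kernelMatrix κ), ‖h‖ ≤ B ∧ ⇑h = f}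

/-- The expected loss `E_{(x,y) ∼ D} ℓ(f(x), y)`. -/
noncomputable def expectedLoss {X Y : Type*} [MeasurableSpace X] [MeasurableSpace Y]
    (D : Measure (X × Y)) (ℓ : ℝ → Y → ℝ) (f : X → ℝ) : ℝ :=
  ∫ z, ℓ (f z.1) z.2 ∂D

/-- The expected loss of `f` is well defined and finite. -/
def HasExpectedLoss {X Y : Type*} [MeasurableSpace X] [MeasurableSpace Y]
    (D : Measure (X × Y)) (ℓ : ℝ → Y → ℝ) (f : X → ℝ) : Prop :=
  Integrable (fun z : X × Y => ℓ (f z.1) z.2) D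

/-! Let `μ` be the marginal of `D` on `X`, and let `Sᵢ` be the inclusion of the RKHS of `κᵢ` in
`L²(μ)`; then `Sᵢ Sᵢ*` is the integral operator of `κᵢ`. Its change from `κ₁` to `κ₂` is at most, in
operator norm, the mean-square distance `η` of the kernels (Hilbert–Schmidt bound). Ridge regression
of `S₁ h₁` on the range of `S₂` with parameter `η` then gives `h₂` with `‖h₂‖ ≤ ‖h₁‖` and `L²` error
at most `√η ‖h₁‖`. A Lipschitz loss turns this error into excess loss
(`RKHS.exists_integral_abs_sub_le`, `expectedLoss_le_of_integral_abs_sub_le`).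

It remains to get `η` of order `ε` with high probability. By Fubini and Markov, pointwise closeness
in probability makes the set of pairs with `|κ₁ - κ₂| ≥ ε` small under `μ.prod μ` for most `ω`; on
that set the bound `2C` on the difference suffices. -/

/-- Ridge regression: if `S₁ S₁* ≤ S₂ S₂* + η`, then every vector in the range of `S₁` is
approximated up to `√η ‖h₁‖` by the image under `S₂` of a vector of no larger norm. -/
theorem exists_norm_sub_le_of_adjoint_le {E H₁ H₂ : Type*}
    [NormedAddCommGroup E] [InnerProductSpace ℝ E] [CompleteSpace E]
    [NormedAddCommGroup H₁] [InnerProductSpace ℝ H₁] [CompleteSpace H₁]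
    [NormedAddCommGroup H₂] [InnerProductSpace ℝ H₂] [CompleteSpace H₂]
    (S₁ : H₁ →L[ℝ] E) (S₂ : H₂ →L[ℝ] E) {η : ℝ} (hη : 0 < η)
    (hS : ∀ r, ‖S₁.adjoint r‖ ^ 2 ≤ ‖S₂.adjoint r‖ ^ 2 + η * ‖r‖ ^ 2) (h₁ : H₁) :
    ∃ h₂ : H₂, ‖h₂‖ ≤ ‖h₁‖ ∧ ‖S₁ h₁ - S₂ h₂‖ ≤ √η * ‖h₁‖ := by
  -- Lax–Milgram for `B` solves the normal equation `(S₂* S₂ + η) h₂ = S₂* S₁ h₁`.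
  let B : H₂ →L[ℝ] H₂ →L[ℝ] ℝ := innerSL ℝ ∘L (S₂.adjoint ∘L S₂ + η • ContinuousLinearMap.id ℝ H₂)
  have hB : ∀ v w, B v w = inner ℝ (S₂ v) (S₂ w) + η * inner ℝ v w := fun v w => by
    change inner ℝ (S₂.adjoint (S₂ v) + η • v) w = _
    rw [inner_add_left, real_inner_smul_left, ContinuousLinearMap.adjoint_inner_left]
  have hc : IsCoercive B := ⟨η, hη, fun u => by
    rw [hB, real_inner_self_eq_norm_sq, real_inner_self_eq_norm_sq]
    nlinarith [sq_nonneg ‖S₂ u‖]⟩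
  obtain ⟨h₂, hh₂⟩ := hc.continuousLinearEquivOfBilin.surjective (S₂.adjoint (S₁ h₁))
  have hw : ∀ w, inner ℝ (S₁ h₁ - S₂ h₂) (S₂ w) = η * inner ℝ h₂ w := fun w => by
    have := hc.continuousLinearEquivOfBilin_apply h₂ w
    rw [hh₂, hB, ContinuousLinearMap.adjoint_inner_left] at this
    rw [inner_sub_left]
    linarith
  set r := S₁ h₁ - S₂ h₂ with hr
  have hadj : S₂.adjoint r = η • h₂ := ext_inner_right ℝ fun w => by
    rw [ContinuousLinearMap.adjoint_inner_left, hw, inner_smul_left]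
    simp
  -- The ridge objective at its minimiser. It equals `⟪r, S₁ h₁⟫`, and the hypothesis on the
  -- adjoints, applied to the residual, bounds `‖S₁* r‖²` by `η J`; so `J ≤ √(η J) ‖h₁‖`.
  set J := ‖r‖ ^ 2 + η * ‖h₂‖ ^ 2 with hJ
  have hJ0 : 0 ≤ J := by positivity
  have hJ1 : J ≤ ‖S₁.adjoint r‖ * ‖h₁‖ := by
    have h := hw h₂
    rw [real_inner_self_eq_norm_sq] at h
    have e : inner ℝ r (S₁ h₁) = J := by
      have : S₁ h₁ = r + S₂ h₂ := by simp [hr]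
      rw [this, inner_add_right, h, real_inner_self_eq_norm_sq]
    rw [← e, ← ContinuousLinearMap.adjoint_inner_left]
    exact real_inner_le_norm _ _
  have hJ2 : ‖S₁.adjoint r‖ ^ 2 ≤ η * J := by
    refine (hS r).trans_eq ?_
    rw [hadj, norm_smul, Real.norm_of_nonneg hη.le]
    ring
  have hJ3 : J ≤ η * ‖h₁‖ ^ 2 := by
    rcases hJ0.eq_or_lt with h0 | h0
    · rw [← h0]; positivity
    · refine le_of_mul_le_mul_left ?_ h0
      calc J * J ≤ (‖S₁.adjoint r‖ * ‖h₁‖) * (‖S₁.adjoint r‖ * ‖h₁‖) :=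
            mul_self_le_mul_self hJ0 hJ1
        _ = ‖S₁.adjoint r‖ ^ 2 * ‖h₁‖ ^ 2 := by ring
        _ ≤ η * J * ‖h₁‖ ^ 2 := by gcongr
        _ = J * (η * ‖h₁‖ ^ 2) := by ring
  refine ⟨h₂, ?_, ?_⟩
  · refine (pow_le_pow_iff_left₀ (by positivity) (by positivity) two_ne_zero).mp ?_
    refine le_of_mul_le_mul_left ?_ hη
    nlinarith [sq_nonneg ‖r‖]
  · refine (pow_le_pow_iff_left₀ (by positivity) (by positivity) two_ne_zero).mp ?_
    rw [mul_pow, Real.sq_sqrt hη.le]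
    nlinarith [mul_nonneg hη.le (sq_nonneg ‖h₂‖)]

/-! ### Reproducing kernel Hilbert spaces inside `L²` -/

section RKHS

variable {X H : Type*} [NormedAddCommGroup H] [InnerProductSpace ℝ H] [CompleteSpace H]
  [RKHS ℝ H X ℝ]

theorem RKHS.kerFun_one_apply (x y : X) : RKHS.kerFun H y 1 x = RKHS.kernel H x y 1 :=
  RKHS.kerFun_apply H y 1 x

theorem RKHS.abs_apply_le {C : ℝ} (hC : ∀ x, RKHS.kernel H x x 1 ≤ C) (f : H) (x : X) :
    |f x| ≤ √C * ‖f‖ := by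
  have h1 : inner ℝ (RKHS.kerFun H x 1) f = f x := by simp
  have h2 : ‖RKHS.kerFun H x 1‖ ≤ √C := by
    refine Real.le_sqrt_of_sq_le ?_
    rw [← real_inner_self_eq_norm_sq, RKHS.kerFun_inner, RKHS.kerFun_one_apply]
    simpa using hC x
  rw [← h1]
  exact (abs_real_inner_le_norm _ _).trans (by gcongr)

theorem RKHS.abs_kernel_le {C : ℝ} (hC : ∀ x, RKHS.kernel H x x 1 ≤ C) (x y : X) :
    |RKHS.kernel H x y 1| ≤ C := by
  have hn : ∀ z, ‖RKHS.kerFun H z 1‖ ^ 2 ≤ C := fun z => by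
    rw [← real_inner_self_eq_norm_sq, RKHS.kerFun_inner, RKHS.kerFun_one_apply]
    simpa using hC z
  have h1 : inner ℝ (RKHS.kerFun H x 1) (RKHS.kerFun H y 1) = RKHS.kernel H x y 1 := by
    rw [RKHS.kerFun_inner, RKHS.kerFun_one_apply]
    simp
  rw [← h1]
  refine (abs_real_inner_le_norm _ _).trans ?_
  nlinarith [hn x, hn y, sq_nonneg (‖RKHS.kerFun H x 1‖ - ‖RKHS.kerFun H y 1‖)]

/-- Combinations of kernel sections are dense, and norm convergence implies pointwise convergence.
-/
theorem RKHS.measurable_coe [MeasurableSpace X]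
    (hm : ∀ y, Measurable fun x => RKHS.kernel H x y 1) (f : H) : Measurable f := by
  have hf : f ∈ closure (Submodule.span ℝ {RKHS.kerFun H x v | (x) (v)} : Set H) := by
    rw [← Submodule.topologicalClosure_coe, RKHS.kerFun_dense]
    trivial
  obtain ⟨u, hu, hlim⟩ := mem_closure_iff_seq_limit.mp hf
  have hspan : ∀ g ∈ Submodule.span ℝ {RKHS.kerFun H x v | (x) (v)}, Measurable (g : X → ℝ) := by
    intro g hg
    induction hg using Submodule.span_induction with
    | mem g hg =>
      obtain ⟨y, v, rfl⟩ := hg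
      have e : RKHS.kerFun H y v = v • RKHS.kerFun H y 1 := by
        rw [← map_smul]
        simp
      rw [e, RKHS.coe_smul]
      refine Measurable.const_smul ?_ v
      convert! hm y using 2 with x
      exact RKHS.kerFun_one_apply x y
    | zero => rw [RKHS.coe_zero]; exact measurable_zero
    | add g g' _ _ hg hg' => rw [RKHS.coe_add]; exact hg.add hg'
    | smul a g _ hg => rw [RKHS.coe_smul]; exact hg.const_smul a
  refine measurable_of_tendsto_metrizable (fun n => hspan _ (hu n)) ?_
  rw [tendsto_pi_nhds]
  exact fun x => ((RKHS.continuous_eval x).tendsto f).comp hlim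

variable [MeasurableSpace X] {C : ℝ}

theorem RKHS.memLp_coe (μ : Measure X) [IsFiniteMeasure μ]
    (hC : ∀ x, RKHS.kernel H x x 1 ≤ C)
    (hm : ∀ y, Measurable fun x => RKHS.kernel H x y 1) (f : H) : MemLp f 2 μ :=
  MemLp.of_bound (RKHS.measurable_coe hm f).aestronglyMeasurable (√C * ‖f‖)
    (Filter.Eventually.of_forall fun x => by
      rw [Real.norm_eq_abs]; exact RKHS.abs_apply_le hC f x)

/-- The inclusion of a reproducing kernel Hilbert space with bounded measurable kernel in `L²`. -/
theorem RKHS.exists_toLp (μ : Measure X) [IsProbabilityMeasure μ]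
    (hC : ∀ x, RKHS.kernel H x x 1 ≤ C)
    (hm : ∀ y, Measurable fun x => RKHS.kernel H x y 1) :
    ∃ S : H →L[ℝ] Lp ℝ 2 μ, ∀ f : H, S f =ᵐ[μ] f := by
  let S₀ : H →ₗ[ℝ] Lp ℝ 2 μ :=
    { toFun := fun f => (RKHS.memLp_coe μ hC hm f).toLp f
      map_add' := fun f g => by
        rw [← MemLp.toLp_add]
        congr 1
        exact RKHS.coe_add f g
      map_smul' := fun a f => by
        rw [RingHom.id_apply, ← MemLp.toLp_const_smul]
        congr 1
        exact RKHS.coe_smul f a }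
  refine ⟨S₀.mkContinuous √C fun f => ?_, fun f => MemLp.coeFn_toLp (RKHS.memLp_coe μ hC hm f)⟩
  have h := Lp.norm_le_of_ae_bound (f := S₀ f) (C := √C * ‖f‖) (by positivity) (by
    filter_upwards [MemLp.coeFn_toLp (RKHS.memLp_coe μ hC hm f)] with x hx
    refine (congrArg norm hx).trans_le ?_
    rw [Real.norm_eq_abs]; exact RKHS.abs_apply_le hC f x)
  simpa [measureUnivNNReal] using h

/-- Pair `S.adjoint r` with the kernel section at `x` and move `S` across. -/
theorem RKHS.adjoint_toLp_apply {μ : Measure X} {S : H →L[ℝ] Lp ℝ 2 μ}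
    (hS : ∀ f : H, S f =ᵐ[μ] f) (r : Lp ℝ 2 μ) (x : X) :
    S.adjoint r x = ∫ y, r y * RKHS.kernel H y x 1 ∂μ := by
  have h1 : inner ℝ (S.adjoint r) (RKHS.kerFun H x 1) = S.adjoint r x := by simp
  rw [← h1, ContinuousLinearMap.adjoint_inner_left, L2.inner_def]
  refine integral_congr_ae ?_
  filter_upwards [hS (RKHS.kerFun H x 1)] with y hy
  rw [hy, RKHS.kerFun_one_apply]
  simp [mul_comm]

theorem RKHS.norm_adjoint_toLp_sq {μ : Measure X} {S : H →L[ℝ] Lp ℝ 2 μ}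
    (hS : ∀ f : H, S f =ᵐ[μ] f) (r : Lp ℝ 2 μ) :
    ‖S.adjoint r‖ ^ 2 = ∫ x, r x * ∫ y, r y * RKHS.kernel H y x 1 ∂μ ∂μ := by
  rw [← real_inner_self_eq_norm_sq, ContinuousLinearMap.adjoint_inner_left, L2.inner_def]
  refine integral_congr_ae ?_
  filter_upwards [hS (S.adjoint r)] with x hx
  rw [hx, RKHS.adjoint_toLp_apply hS]
  simp [mul_comm]

end RKHS

/-! ### Integral inequalities and comparison of two kernels -/

theorem MeasureTheory.L2.norm_sq_eq_integral {X : Type*} [MeasurableSpace X] {μ : Measure X}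
    (r : Lp ℝ 2 μ) : ‖r‖ ^ 2 = ∫ x, r x ^ 2 ∂μ := by
  rw [← real_inner_self_eq_norm_sq, L2.inner_def]
  refine integral_congr_ae (Filter.Eventually.of_forall fun x => ?_)
  simp [pow_two]

/-- Cauchy–Schwarz for the quadratic form of a Hilbert–Schmidt kernel, in polarized form. -/
theorem MeasureTheory.two_mul_integral_prod_mul_le {X : Type*} [MeasurableSpace X]
    {μ : Measure X} [IsProbabilityMeasure μ] {d : X × X → ℝ} (hd : Measurable d) {C η : ℝ}
    (hb : ∀ p, |d p| ≤ C) (hη : ∫ p, d p ^ 2 ∂μ.prod μ ≤ η ^ 2) (r : Lp ℝ 2 μ) :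
    2 * (η * ‖r‖ ^ 2) * ∫ p, r p.1 * r p.2 * d p ∂μ.prod μ ≤ 2 * (η * ‖r‖ ^ 2) ^ 2 := by
  have hr2 : Integrable (fun x => r x ^ 2) μ := (Lp.memLp r).integrable_sq
  have hr1 : Integrable (fun x => r x) μ := (Lp.memLp r).integrable one_le_two
  have hF : Integrable (fun p : X × X => (r p.1 * r p.2) ^ 2) (μ.prod μ) := by
    simpa only [mul_pow] using hr2.mul_prod hr2
  have hFd : Integrable (fun p : X × X => r p.1 * r p.2 * d p) (μ.prod μ) :=
    (hr1.mul_prod hr1).mul_bdd (c := C) hd.aestronglyMeasurable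
      (Filter.Eventually.of_forall fun p => hb p)
  have hd2 : Integrable (fun p => d p ^ 2) (μ.prod μ) :=
    Integrable.of_bound (hd.pow_const 2).aestronglyMeasurable (C ^ 2)
      (Filter.Eventually.of_forall fun p => by
        rw [norm_pow]
        exact pow_le_pow_left₀ (norm_nonneg _) (hb p) 2)
  have hF2 : ∫ p : X × X, (r p.1 * r p.2) ^ 2 ∂μ.prod μ = (‖r‖ ^ 2) ^ 2 := by
    simp only [mul_pow]
    rw [integral_prod_mul (fun x => r x ^ 2) (fun x => r x ^ 2), ← L2.norm_sq_eq_integral]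
    ring
  set N := ‖r‖ ^ 2
  calc 2 * (η * N) * ∫ p, r p.1 * r p.2 * d p ∂μ.prod μ
      = ∫ p, 2 * (η * N) * (r p.1 * r p.2 * d p) ∂μ.prod μ := (integral_const_mul _ _).symm
    _ ≤ ∫ p, (η ^ 2 * (r p.1 * r p.2) ^ 2 + N ^ 2 * d p ^ 2) ∂μ.prod μ := by
        refine integral_mono (hFd.const_mul _) ((hF.const_mul _).add (hd2.const_mul _)) fun p => ?_
        -- Expanding this square gives the pointwise inequality, so no square root of an integral is
        -- needed.
        have := sq_nonneg (η * (r p.1 * r p.2) - N * d p)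
        simp only
        linarith
    _ = η ^ 2 * N ^ 2 + N ^ 2 * ∫ p, d p ^ 2 ∂μ.prod μ := by
        rw [integral_add (hF.const_mul _) (hd2.const_mul _), integral_const_mul,
          integral_const_mul, hF2]
    _ ≤ η ^ 2 * N ^ 2 + N ^ 2 * η ^ 2 := by gcongr
    _ = 2 * (η * N) ^ 2 := by ring

/-- The variance of `|g|` is nonnegative. -/
theorem MeasureTheory.sq_integral_abs_le {X : Type*} [MeasurableSpace X] {μ : Measure X}
    [IsProbabilityMeasure μ] {g : X → ℝ} (hg : MemLp g 2 μ) :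
    (∫ x, |g x| ∂μ) ^ 2 ≤ ∫ x, g x ^ 2 ∂μ := by
  have h := variance_nonneg |g| μ
  rw [variance_eq_sub hg.abs] at h
  simpa using h

section RKHS

variable {X H H' : Type*} [NormedAddCommGroup H] [InnerProductSpace ℝ H] [CompleteSpace H]
  [RKHS ℝ H X ℝ] [NormedAddCommGroup H'] [InnerProductSpace ℝ H'] [CompleteSpace H']
  [RKHS ℝ H' X ℝ] [MeasurableSpace X] {C : ℝ}

theorem RKHS.norm_adjoint_toLp_sq_eq_integral_prod {μ : Measure X} [IsProbabilityMeasure μ]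
    (hC : ∀ x, RKHS.kernel H x x 1 ≤ C)
    (hm : Measurable fun p : X × X => RKHS.kernel H p.1 p.2 1)
    {S : H →L[ℝ] Lp ℝ 2 μ} (hS : ∀ f : H, S f =ᵐ[μ] f) (r : Lp ℝ 2 μ) :
    Integrable (fun p : X × X => r p.1 * r p.2 * RKHS.kernel H p.2 p.1 1) (μ.prod μ) ∧
    ‖S.adjoint r‖ ^ 2 = ∫ p, r p.1 * r p.2 * RKHS.kernel H p.2 p.1 1 ∂μ.prod μ := by
  have hr1 : Integrable (fun x => r x) μ := (Lp.memLp r).integrable one_le_two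
  have hi : Integrable (fun p : X × X => r p.1 * r p.2 * RKHS.kernel H p.2 p.1 1) (μ.prod μ) :=
    (hr1.mul_prod hr1).mul_bdd (c := C) (hm.comp measurable_swap).aestronglyMeasurable
      (Filter.Eventually.of_forall fun p => RKHS.abs_kernel_le hC p.2 p.1)
  refine ⟨hi, ?_⟩
  rw [RKHS.norm_adjoint_toLp_sq hS, integral_prod _ hi]
  simp only [mul_assoc, integral_const_mul]

/-- If two bounded measurable kernels are close in mean square, then every function in the
reproducing kernel Hilbert space of the first is close in mean to a function of no larger norm
in the space of the second. -/
theorem RKHS.exists_integral_abs_sub_le (μ : Measure X) [IsProbabilityMeasure μ]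
    (hC : ∀ x, RKHS.kernel H x x 1 ≤ C) (hC' : ∀ x, RKHS.kernel H' x x 1 ≤ C)
    (hm : Measurable fun p : X × X => RKHS.kernel H p.1 p.2 1)
    (hm' : Measurable fun p : X × X => RKHS.kernel H' p.1 p.2 1) {η : ℝ} (hη : 0 < η)
    (hd : ∫ p : X × X, (RKHS.kernel H p.1 p.2 1 - RKHS.kernel H' p.1 p.2 1) ^ 2 ∂μ.prod μ
      ≤ η ^ 2) (f : H) :
    ∃ g : H', ‖g‖ ≤ ‖f‖ ∧ ∫ x, |f x - g x| ∂μ ≤ √η * ‖f‖ := by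
  have hm1 : ∀ y, Measurable fun x => RKHS.kernel H x y 1 := fun y =>
    Measurable.of_uncurry_right (f := fun x y => RKHS.kernel H x y 1) hm
  have hm1' : ∀ y, Measurable fun x => RKHS.kernel H' x y 1 := fun y =>
    Measurable.of_uncurry_right (f := fun x y => RKHS.kernel H' x y 1) hm'
  obtain ⟨S, hS⟩ := RKHS.exists_toLp μ hC hm1
  obtain ⟨S', hS'⟩ := RKHS.exists_toLp μ hC' hm1'
  -- The operator inequality `S S* ≤ S' S'* + η`, read on quadratic forms.
  have key : ∀ r, ‖S.adjoint r‖ ^ 2 ≤ ‖S'.adjoint r‖ ^ 2 + η * ‖r‖ ^ 2 := fun r => by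
    rcases eq_or_ne r 0 with rfl | hr
    · simp
    have hN : 0 < ‖r‖ := norm_pos_iff.mpr hr
    obtain ⟨hi, he⟩ := RKHS.norm_adjoint_toLp_sq_eq_integral_prod hC hm hS r
    obtain ⟨hi', he'⟩ := RKHS.norm_adjoint_toLp_sq_eq_integral_prod hC' hm' hS' r
    have hs : ∫ p : X × X, (RKHS.kernel H p.2 p.1 1 - RKHS.kernel H' p.2 p.1 1) ^ 2 ∂μ.prod μ
        ≤ η ^ 2 :=
      (integral_prod_swap (μ := μ) (ν := μ)
        fun p : X × X => (RKHS.kernel H p.1 p.2 1 - RKHS.kernel H' p.1 p.2 1) ^ 2).trans_le hd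
    have h := two_mul_integral_prod_mul_le (C := C + C)
      ((hm.comp measurable_swap).sub (hm'.comp measurable_swap))
      (fun p => (abs_sub _ _).trans
        (add_le_add (RKHS.abs_kernel_le hC p.2 p.1) (RKHS.abs_kernel_le hC' p.2 p.1))) hs r
    have e : ∫ p : X × X, r p.1 * r p.2 *
        (RKHS.kernel H p.2 p.1 1 - RKHS.kernel H' p.2 p.1 1) ∂μ.prod μ
        = ‖S.adjoint r‖ ^ 2 - ‖S'.adjoint r‖ ^ 2 := by
      rw [he, he', ← integral_sub hi hi']
      simp only [mul_sub]
    have h2 : 2 * (η * ‖r‖ ^ 2) * (‖S.adjoint r‖ ^ 2 - ‖S'.adjoint r‖ ^ 2)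
        ≤ 2 * (η * ‖r‖ ^ 2) * (η * ‖r‖ ^ 2) := by
      rw [← e]
      refine h.trans_eq (by ring)
    have := le_of_mul_le_mul_left h2 (by positivity)
    linarith
  obtain ⟨g, hg, hfg⟩ := exists_norm_sub_le_of_adjoint_le S S' hη key f
  refine ⟨g, hg, (le_trans ?_ hfg)⟩
  refine (pow_le_pow_iff_left₀ (integral_nonneg fun x => abs_nonneg _) (norm_nonneg _)
    two_ne_zero).mp ?_
  refine (sq_integral_abs_le
    ((RKHS.memLp_coe μ hC hm1 f).sub (RKHS.memLp_coe μ hC' hm1' g))).trans_eq ?_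
  rw [L2.norm_sq_eq_integral]
  refine integral_congr_ae ?_
  filter_upwards [Lp.coeFn_sub (S f) (S' g), hS f, hS' g] with x h1 h2 h3
  rw [h1, Pi.sub_apply, Pi.sub_apply, h2, h3]

end RKHS

/-! ### From `L¹` closeness to expected loss -/

theorem expectedLoss_le_of_integral_abs_sub_le {X Y : Type*} [MeasurableSpace X]
    [MeasurableSpace Y] (D : Measure (X × Y)) {L : ℝ≥0} {ℓ : ℝ → Y → ℝ}
    (hℓ : Measurable (Function.uncurry ℓ)) (hL : ∀ y, LipschitzWith L fun t => ℓ t y)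
    {f g : X → ℝ} (hg : Measurable g) (hfg : Integrable (fun x => f x - g x) (D.map Prod.fst))
    {b : ℝ} (hb : ∫ x, |f x - g x| ∂D.map Prod.fst ≤ b) (hf : HasExpectedLoss D ℓ f) :
    HasExpectedLoss D ℓ g ∧ expectedLoss D ℓ g ≤ expectedLoss D ℓ f + L * b := by
  have hi : Integrable (fun z : X × Y => L * |f z.1 - g z.1|) D :=
    ((hfg.comp_measurable measurable_fst).abs).const_mul _
  have hle : ∀ z : X × Y, |ℓ (g z.1) z.2 - ℓ (f z.1) z.2| ≤ L * |f z.1 - g z.1| := fun z => by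
    have := (hL z.2).dist_le_mul (g z.1) (f z.1)
    rwa [Real.dist_eq, Real.dist_eq, abs_sub_comm (g z.1)] at this
  have hgm : Measurable fun z : X × Y => ℓ (g z.1) z.2 :=
    hℓ.comp ((hg.comp measurable_fst).prodMk measurable_snd)
  have hgi : HasExpectedLoss D ℓ g := by
    refine (hf.abs.add hi).mono' hgm.aestronglyMeasurable
      (Filter.Eventually.of_forall fun z => ?_)
    have h1 := hle z
    have h2 := abs_sub_abs_le_abs_sub (ℓ (g z.1) z.2) (ℓ (f z.1) z.2)
    simp only [Real.norm_eq_abs, Pi.add_apply]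
    linarith
  refine ⟨hgi, ?_⟩
  calc expectedLoss D ℓ g ≤ ∫ z, (ℓ (f z.1) z.2 + L * |f z.1 - g z.1|) ∂D :=
        integral_mono hgi (hf.add hi) fun z => by
          have := (abs_le.mp (hle z)).2
          simp only
          linarith
    _ = expectedLoss D ℓ f + L * ∫ x, |f x - g x| ∂D.map Prod.fst := by
        rw [integral_add hf hi, integral_const_mul,
          integral_map measurable_fst.aemeasurable hfg.abs.aestronglyMeasurable]
        rfl
    _ ≤ _ := by gcongr

theorem RKHS.exists_expectedLoss_le {X Y H H' : Type*} [NormedAddCommGroup H]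
    [InnerProductSpace ℝ H] [CompleteSpace H] [RKHS ℝ H X ℝ] [NormedAddCommGroup H']
    [InnerProductSpace ℝ H'] [CompleteSpace H'] [RKHS ℝ H' X ℝ] [MeasurableSpace X]
    [MeasurableSpace Y] (D : Measure (X × Y)) [IsProbabilityMeasure D] {L : ℝ≥0} {ℓ : ℝ → Y → ℝ}
    (hℓ : Measurable (Function.uncurry ℓ)) (hL : ∀ y, LipschitzWith L fun t => ℓ t y)
    {κ₁ κ₂ : X → X → ℝ} (hk₁ : ∀ x y, RKHS.kernel H x y 1 = κ₁ x y)
    (hk₂ : ∀ x y, RKHS.kernel H' x y 1 = κ₂ x y)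
    (hm₁ : Measurable fun p : X × X => κ₁ p.1 p.2) (hm₂ : Measurable fun p : X × X => κ₂ p.1 p.2)
    {C η : ℝ} (hC₁ : ∀ x, κ₁ x x ≤ C) (hC₂ : ∀ x, κ₂ x x ≤ C) (hη : 0 < η)
    (hd : ∫ p : X × X, (κ₁ p.1 p.2 - κ₂ p.1 p.2) ^ 2 ∂(D.map Prod.fst).prod (D.map Prod.fst)
      ≤ η ^ 2) (h : H) (hf : HasExpectedLoss D ℓ h) :
    ∃ g : H', ‖g‖ ≤ ‖h‖ ∧ HasExpectedLoss D ℓ g ∧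
      expectedLoss D ℓ g ≤ expectedLoss D ℓ h + L * (√η * ‖h‖) := by
  have : IsProbabilityMeasure (D.map (Prod.fst : X × Y → X)) :=
    Measure.isProbabilityMeasure_map measurable_fst.aemeasurable
  simp only [← hk₁, ← hk₂] at hm₁ hm₂ hC₁ hC₂ hd
  obtain ⟨g, hg, hhg⟩ := RKHS.exists_integral_abs_sub_le _ hC₁ hC₂ hm₁ hm₂ hη hd h
  have hc₁ : ∀ y, Measurable fun x => RKHS.kernel H x y 1 := fun y =>
    Measurable.of_uncurry_right (f := fun x y => RKHS.kernel H x y 1) hm₁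
  have hc₂ : ∀ y, Measurable fun x => RKHS.kernel H' x y 1 := fun y =>
    Measurable.of_uncurry_right (f := fun x y => RKHS.kernel H' x y 1) hm₂
  refine ⟨g, hg, expectedLoss_le_of_integral_abs_sub_le D hℓ hL (RKHS.measurable_coe hc₂ g) ?_
    hhg hf⟩
  exact ((RKHS.memLp_coe _ hC₁ hc₁ h).sub (RKHS.memLp_coe _ hC₂ hc₂ g)).integrable one_le_two

theorem RKHS.kernel_ofKernel_kernelMatrix {X : Type*} {κ : X → X → ℝ}
    [Fact (kernelMatrix κ).PosSemidef] (x y : X) :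
    RKHS.kernel (RKHS.OfKernel (kernelMatrix κ)) x y 1 = κ x y := by
  rw [RKHS.OfKernel.kernel_ofKernel]
  simp [kernelMatrix]

/-- If two bounded measurable kernels are close in mean square, then every predictor in the ball of
the first is matched by a predictor in the ball of the second. -/
theorem exists_mem_kernelBall_expectedLoss_le {X Y : Type*} [MeasurableSpace X]
    [MeasurableSpace Y] (D : Measure (X × Y)) [IsProbabilityMeasure D] {L : ℝ≥0} {ℓ : ℝ → Y → ℝ}
    (hℓ : Measurable (Function.uncurry ℓ)) (hL : ∀ y, LipschitzWith L fun t => ℓ t y)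
    {κ₁ κ₂ : X → X → ℝ} (hκ₁ : IsReproducingKernel κ₁) (hκ₂ : IsReproducingKernel κ₂)
    (hm₁ : Measurable fun p : X × X => κ₁ p.1 p.2) (hm₂ : Measurable fun p : X × X => κ₂ p.1 p.2)
    {C η M : ℝ} (hC₁ : ∀ x, κ₁ x x ≤ C) (hC₂ : ∀ x, κ₂ x x ≤ C) (hη : 0 < η)
    (hd : ∫ p : X × X, (κ₁ p.1 p.2 - κ₂ p.1 p.2) ^ 2 ∂(D.map Prod.fst).prod (D.map Prod.fst)
      ≤ η ^ 2) {f₁ : X → ℝ} (hf₁ : f₁ ∈ kernelBall κ₁ hκ₁ M) (hf : HasExpectedLoss D ℓ f₁) :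
    ∃ f₂ ∈ kernelBall κ₂ hκ₂ M, HasExpectedLoss D ℓ f₂ ∧
      expectedLoss D ℓ f₂ ≤ expectedLoss D ℓ f₁ + L * (√η * M) := by
  have : Fact (kernelMatrix κ₁).PosSemidef := ⟨hκ₁.posSemidef_kernelMatrix⟩
  have : Fact (kernelMatrix κ₂).PosSemidef := ⟨hκ₂.posSemidef_kernelMatrix⟩
  obtain ⟨h, hh, rfl⟩ := hf₁
  obtain ⟨g, hg, hl, hle⟩ := RKHS.exists_expectedLoss_le
    (H' := RKHS.OfKernel (kernelMatrix κ₂)) D hℓ hL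
    RKHS.kernel_ofKernel_kernelMatrix RKHS.kernel_ofKernel_kernelMatrix hm₁ hm₂ hC₁ hC₂ hη hd h hf
  exact ⟨g, ⟨g, hg.trans hh, rfl⟩, hl, hle.trans (by gcongr)⟩

theorem kernelBall_mono {X : Type*} {κ : X → X → ℝ} (hκ : IsReproducingKernel κ) {B B' : ℝ}
    (h : B ≤ B') : kernelBall κ hκ B ⊆ kernelBall κ hκ B' := by
  rintro f ⟨g, hg, rfl⟩
  exact ⟨g, hg.trans h, rfl⟩

/-- Since `M` may have any sign, this supplies the `0 ≤ M` needed to pass from radius `M` to `√2 *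
M`. -/
theorem nonneg_of_mem_kernelBall {X : Type*} {κ : X → X → ℝ} {hκ : IsReproducingKernel κ} {B : ℝ}
    {f : X → ℝ} (hf : f ∈ kernelBall κ hκ B) : 0 ≤ B := by
  obtain ⟨g, hg, -⟩ := hf
  exact (norm_nonneg _).trans hg

theorem IsReproducingKernel.abs_le {X : Type*} {κ : X → X → ℝ} (hκ : IsReproducingKernel κ)
    {C : ℝ} (hC : ∀ x, κ x x ≤ C) (x y : X) : |κ x y| ≤ C := by
  have : Fact (kernelMatrix κ).PosSemidef := ⟨hκ.posSemidef_kernelMatrix⟩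
  rw [← RKHS.kernel_ofKernel_kernelMatrix (κ := κ)]
  refine RKHS.abs_kernel_le (fun z => ?_) x y
  rw [RKHS.kernel_ofKernel_kernelMatrix]
  exact hC z

/-! ### Mean-square closeness with high probability -/

theorem integral_sq_le_of_measureReal_le {Z : Type*} [MeasurableSpace Z] {μ : Measure Z}
    [IsProbabilityMeasure μ] {d : Z → ℝ} (hd : Measurable d) {C ε t : ℝ}
    (hC : ∀ z, |d z| ≤ C) (ht : μ.real {z | ε ≤ |d z|} ≤ t) :
    ∫ z, d z ^ 2 ∂μ ≤ ε ^ 2 + C ^ 2 * t := by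
  set A := {z | ε ≤ |d z|}
  have hA : MeasurableSet A := measurableSet_le measurable_const hd.abs
  have hi : Integrable (A.indicator fun _ => C ^ 2) μ := (integrable_const _).indicator hA
  have hd2 : Integrable (fun z => d z ^ 2) μ :=
    Integrable.of_bound (hd.pow_const 2).aestronglyMeasurable (C ^ 2)
      (Filter.Eventually.of_forall fun z => by
        rw [norm_pow]
        exact pow_le_pow_left₀ (norm_nonneg _) (hC z) 2)
  calc ∫ z, d z ^ 2 ∂μ ≤ ∫ z, (ε ^ 2 + A.indicator (fun _ => C ^ 2) z) ∂μ := by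
        refine integral_mono hd2 ((integrable_const _).add hi) fun z => ?_
        simp only
        rw [← sq_abs (d z)]
        by_cases hz : z ∈ A
        · rw [Set.indicator_of_mem hz]
          have := pow_le_pow_left₀ (abs_nonneg _) (hC z) 2
          nlinarith [sq_nonneg ε]
        · rw [Set.indicator_of_notMem hz, add_zero]
          exact pow_le_pow_left₀ (abs_nonneg _) (not_le.mp hz).le 2
    _ = ε ^ 2 + C ^ 2 * μ.real A := by
        rw [integral_add (integrable_const _) hi, integral_indicator_const _ hA]
        simp [mul_comm]
    _ ≤ _ := by gcongr

/-- Fubini and Markov: a set in a product all of whose sections over `Z` have probability at most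
`a` has, with high probability, small sections over `Ω`. -/
theorem measureReal_lt_measureReal_section_mul_le {Ω Z : Type*} [MeasurableSpace Ω]
    [MeasurableSpace Z] (P : Measure Ω) [IsProbabilityMeasure P] (μ : Measure Z)
    [IsProbabilityMeasure μ] {A : Set (Ω × Z)} (hA : MeasurableSet A) {a t : ℝ}
    (ha : ∀ z, P.real {ω | (ω, z) ∈ A} ≤ a) (ht : 0 ≤ t) :
    t * P.real {ω | t < μ.real {z | (ω, z) ∈ A}} ≤ a := by
  have hi : Integrable (fun ω => μ.real {z | (ω, z) ∈ A}) P :=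
    Integrable.of_bound (measurable_measure_prodMk_left hA).ennreal_toReal.aestronglyMeasurable 1
      (Filter.Eventually.of_forall fun ω => by
        rw [Real.norm_of_nonneg measureReal_nonneg]; exact measureReal_le_one)
  have hi' : Integrable (fun z => P.real {ω | (ω, z) ∈ A}) μ :=
    Integrable.of_bound (measurable_measure_prodMk_right hA).ennreal_toReal.aestronglyMeasurable 1
      (Filter.Eventually.of_forall fun ω => by
        rw [Real.norm_of_nonneg measureReal_nonneg]; exact measureReal_le_one)
  have hsw : ∫ ω, μ.real {z | (ω, z) ∈ A} ∂P = ∫ z, P.real {ω | (ω, z) ∈ A} ∂μ := by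
    change ∫ ω, (μ (Prod.mk ω ⁻¹' A)).toReal ∂P = ∫ z, (P ((fun ω => (ω, z)) ⁻¹' A)).toReal ∂μ
    rw [integral_toReal (measurable_measure_prodMk_left hA).aemeasurable
        (Filter.Eventually.of_forall fun _ => measure_lt_top _ _),
      integral_toReal (measurable_measure_prodMk_right hA).aemeasurable
        (Filter.Eventually.of_forall fun _ => measure_lt_top _ _)]
    exact congrArg ENNReal.toReal ((Measure.prod_apply hA).symm.trans (Measure.prod_apply_symm hA))
  calc t * P.real {ω | t < μ.real {z | (ω, z) ∈ A}}
      ≤ t * P.real {ω | t ≤ μ.real {z | (ω, z) ∈ A}} :=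
        mul_le_mul_of_nonneg_left
          (measureReal_mono (fun ω (hω : t < _) => hω.le) (measure_ne_top P _)) ht
    _ ≤ ∫ ω, μ.real {z | (ω, z) ∈ A} ∂P :=
        mul_meas_ge_le_integral_of_nonneg
          (Filter.Eventually.of_forall fun _ => measureReal_nonneg) hi t
    _ = ∫ z, P.real {ω | (ω, z) ∈ A} ∂μ := hsw
    _ ≤ ∫ _, a ∂μ := integral_mono hi' (integrable_const _) ha
    _ = a := by simp

theorem mainTheorem9 :
    ∃ c₂ : ℝ, 0 < c₂ ∧
      ∀ {X Y Ω : Type*} [MeasurableSpace X] [MeasurableSpace Y] [MeasurableSpace Ω]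
        (D : Measure (X × Y)) [IsProbabilityMeasure D]
        (P : Measure Ω) [IsProbabilityMeasure P]
        (L : ℝ≥0) (ℓ : ℝ → Y → ℝ) (_ : Measurable (Function.uncurry ℓ))
        (_ : ∀ y, LipschitzWith L fun t => ℓ t y)
        (κ₁ κ₂ : Ω → X → X → ℝ)
        (hκ₁ : ∀ ω, IsReproducingKernel (κ₁ ω)) (hκ₂ : ∀ ω, IsReproducingKernel (κ₂ ω))
        (_ : Measurable fun p : Ω × X × X => κ₁ p.1 p.2.1 p.2.2)
        (_ : Measurable fun p : Ω × X × X => κ₂ p.1 p.2.1 p.2.2)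
        (_ : IndepFun κ₁ κ₂ P)
        (C ε δ δ' M : ℝ) (_ : 0 < C) (_ : 0 < ε) (_ : 0 < δ)
        (_ : ∀ᵐ ω ∂P, ∀ x, κ₁ ω x x ≤ C ∧ κ₂ ω x x ≤ C)
        (_ : ∀ x y, P.real {ω | ε ≤ |κ₁ ω x y - κ₂ ω x y|} ≤ δ')
        (_ : δ' < c₂ * (ε ^ 2 * δ / (C ^ 2 * max 1 (Real.log (1 / δ)) ^ 2))),
        ∃ E : Set Ω, MeasurableSet E ∧ 1 - δ ≤ P.real E ∧
          ∀ ω ∈ E, ∀ f₁ ∈ kernelBall (κ₁ ω) (hκ₁ ω) M, HasExpectedLoss D ℓ f₁ →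
            ∃ f₂ ∈ kernelBall (κ₂ ω) (hκ₂ ω) (√2 * M), HasExpectedLoss D ℓ f₂ ∧
              expectedLoss D ℓ f₂ ≤ expectedLoss D ℓ f₁ + √ε * 4 * L * M := by
  refine ⟨1, one_pos, ?_⟩
  intro X Y Ω _ _ _ D _ P _ L ℓ hℓ hL κ₁ κ₂ hκ₁ hκ₂ hm₁ hm₂ _ C ε δ δ' M hC hε hδ hdiag hclose hδ'
  have : IsProbabilityMeasure (D.map (Prod.fst : X × Y → X)) :=
    Measure.isProbabilityMeasure_map measurable_fst.aemeasurable
  set μ : Measure X := D.map Prod.fst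
  let A : Set (Ω × X × X) := {p | ε ≤ |κ₁ p.1 p.2.1 p.2.2 - κ₂ p.1 p.2.1 p.2.2|}
  have hA : MeasurableSet A := measurableSet_le measurable_const (hm₁.sub hm₂).abs
  -- Chosen so that the exceptional set adds at most `(2C)² t = 4ε²` to the mean square, while
  -- Markov's bound `δ' / t` stays at most `δ`, already with `c₂ = 1`.
  set t := ε ^ 2 / C ^ 2 with ht
  have ht0 : 0 < t := by positivity
  let bad : Set Ω := {ω | t < (μ.prod μ).real {z | (ω, z) ∈ A}}
  have hbad : MeasurableSet bad :=
    measurableSet_lt measurable_const (measurable_measure_prodMk_left hA).ennreal_toReal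
  have hδt : δ' ≤ t * δ := by
    refine hδ'.le.trans ?_
    have hmax : 1 ≤ max 1 (Real.log (1 / δ)) ^ 2 := one_le_pow₀ (le_max_left _ _)
    calc 1 * (ε ^ 2 * δ / (C ^ 2 * max 1 (Real.log (1 / δ)) ^ 2))
        ≤ ε ^ 2 * δ / C ^ 2 := by
          rw [one_mul]
          gcongr
          exact le_mul_of_one_le_right (by positivity) hmax
      _ = t * δ := by rw [ht]; ring
  have hPbad : P.real bad ≤ δ :=
    le_of_mul_le_mul_left ((measureReal_lt_measureReal_section_mul_le P (μ.prod μ) hA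
      (fun z => hclose z.1 z.2) ht0.le).trans hδt) ht0
  -- The diagonal condition ranges over all `x`, so its failure set need not be measurable; a
  -- measurable null superset replaces it.
  obtain ⟨G, hGsub, hG, hPG⟩ := exists_measurable_superset_of_null (ae_iff.mp hdiag)
  refine ⟨(bad ∪ G)ᶜ, (hbad.union hG).compl, ?_, ?_⟩
  · rw [probReal_compl_eq_one_sub (hbad.union hG)]
    have h1 := measureReal_union_le (μ := P) bad G
    have h2 : P.real G = 0 := by rw [measureReal_def, hPG]; simp
    linarith
  intro ω hω f₁ hf₁ hf
  rw [Set.compl_union] at hω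
  have hdω : ∀ x, κ₁ ω x x ≤ C ∧ κ₂ ω x x ≤ C := by
    by_contra h
    exact hω.2 (hGsub h)
  have hsec₁ : Measurable fun p : X × X => κ₁ ω p.1 p.2 := hm₁.comp measurable_prodMk_left
  have hsec₂ : Measurable fun p : X × X => κ₂ ω p.1 p.2 := hm₂.comp measurable_prodMk_left
  -- The total is `ε² + 4ε² = 5ε²`, rounded up to `(3ε)²`; hence `η = 3ε`, and `√3 ≤ 4` gives the
  -- final constant.
  have hint : ∫ p : X × X, (κ₁ ω p.1 p.2 - κ₂ ω p.1 p.2) ^ 2 ∂μ.prod μ ≤ (3 * ε) ^ 2 := by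
    refine (integral_sq_le_of_measureReal_le (C := C + C) (ε := ε) (t := t) (hsec₁.sub hsec₂)
      (fun p => (abs_sub _ _).trans (add_le_add
        ((hκ₁ ω).abs_le (fun x => (hdω x).1) p.1 p.2)
        ((hκ₂ ω).abs_le (fun x => (hdω x).2) p.1 p.2))) (not_lt.mp hω.1)).trans ?_
    have : (C + C) ^ 2 * t = 4 * ε ^ 2 := by rw [ht]; field_simp; ring
    rw [this]
    nlinarith [sq_nonneg ε]
  have hM := nonneg_of_mem_kernelBall hf₁
  obtain ⟨f₂, hf₂, hl, hle⟩ := exists_mem_kernelBall_expectedLoss_le D hℓ hL (hκ₁ ω) (hκ₂ ω)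
    hsec₁ hsec₂ (fun x => (hdω x).1) (fun x => (hdω x).2) (by positivity) hint hf₁ hf
  refine ⟨f₂, kernelBall_mono (hκ₂ ω) ?_ hf₂, hl, hle.trans ?_⟩
  · exact le_mul_of_one_le_left hM (Real.one_le_sqrt.mpr one_le_two)
  · have h3 : √(3 * ε) ≤ 4 * √ε := by
      rw [Real.sqrt_le_left (by positivity), mul_pow, Real.sq_sqrt hε.le]
      linarith
    have : L * (√(3 * ε) * M) ≤ L * (4 * √ε * M) := by gcongr
    linarith
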